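/- Let $N,d,H$ be nonnegative integers and let $\ell:\mathbb{R}\times\mathbb{R}\to\mathbb{R}$ be continuously differentiable with locally Lipschitz gradient. Let $(x_i,y_i)\in\mathbb{R}^d\times\mathbb{R}$, $i=1,\dots,N$, be data with $x_i\neq 0$ for all $i$ (this holds automatically in the parametrization $x_i=(\tilde x_i,1)$), and consider the empirical loss of the two-layer ReLU network with $H$ hidden nodes, $$L(u_1,w_1,\dots,u_H,w_H)=\sum_{i=1}^N \ell\Big(\sum_{k=1}^H u_k\max\{w_k^\top x_i,0\},\;y_i\Big),\qquad (u_k,w_k)\in\mathbb{R}\times\mathbb{R}^d .$$ At a given point $(u_k,w_k)_{k=1}^H$ let $\rho_i=\partial_1\ell\big(\sum_{k} u_k\max\{w_k^\top x_i,0\},y_i\big)$, where $\partial_1$ is the derivative in the first argument, and for each $k$ let $$\mathcal I_k^+=\{i: w_k^\top x_i=0,\ u_k\rho_i\ge 0\},\qquad \mathcal I_k^-=\{i: w_k^\top x_i=0,\ u_k\rho_i<0\}.$$ The point satisfies the span qualification (SQ) if $\operatorname{span}\{x_i\}_{i\in\mathcal I_k^+}\cap\operatorname{span}\{x_j\}_{j\in\mathcal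 I_k^-}=\{0\}$ for every $k$. For a locally Lipschitz function $f:\mathbb{R}^n\to\mathbb{R}$ that has one-sided directional derivatives $f'(z;v)$ at all points $z$ in all directions $v$, the Clarke subdifferential is $\partial_C f(z)=\operatorname{Conv}\{s:\exists z_\nu\to z,\ \nabla f(z_\nu)\text{ exists},\ \nabla f(z_\nu)\to s\}$, the Fréchet subdifferential is $\widehat\partial f(z)=\{s: s^\top v\le f'(z;v)\ \text{for all } v\}$, and $f$ is Clarke regular at $z$ if $\partial_C f(z)=\widehat\partial f(z)$. The data are in general position if no $d$ of the points $x_i$ lie on one hyperplane through the origin of $\mathbb{R}^d$, that is, there are no $w\in\mathbb{R}^d\setminus\{0\}$ and $\mathcal J\subseteq\{1,\dots,N\}$ with $|\mathcal J|\ge d$ and $w^\top x_j=0$ for all $j\in\mathcal J$ (for $x_i=(\tilde x_i,1)$: no $d$ of the $\tilde x_i$ lie on one affine hyperplane of $\mathbb{R}^{d-1}$); if $N<d$, where this condition is void, general position means that $x_1,\dots,x_N$ are linearly independent. Then $L$ is locally Lipschitz and directionally differentiable, and: 1. If SQ holds at a point and $\widehat\partial L\neq\emptyset$ at that point, then $L$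 is Clarke regular at that point. 2. If the data are in general position, then $L$ is Clarke regular at every local minimizer $(u_k,w_k)_{k=1}^H$ of $L$ at which $w_k\neq 0$ for every $k$ with $u_k\neq 0$ (if $N\le d$, this proviso is not needed). -/

import Mathlib

open Filter Topology

noncomputable section

namespace ReLULoss

section Subdifferentials

variable {E : Type*} [NormedAddCommGroup E] [InnerProductSpace ℝ E]

/-- The one-sided directional derivative `f'(x; v)` exists and equals `c`. -/
def HasDirDerivAt (f : E → ℝ) (x v : E) (c : ℝ) : Prop :=
  Tendsto (fun t : ℝ => (f (x + t • v) - f x) / t) (𝓝[>] 0) (𝓝 c)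

/-- `f` has a one-sided directional derivative at every point in every direction. -/
def DirDifferentiable (f : E → ℝ) : Prop :=
  ∀ x v : E, ∃ c : ℝ, HasDirDerivAt f x v c

/-- The Clarke subdifferential of a locally Lipschitz function at `x`: the convex hull of the
limits of gradients of `f` along sequences of points of differentiability that converge to `x`. -/
def clarkeSubdiff [CompleteSpace E] (f : E → ℝ) (x : E) : Set E :=
  convexHull ℝ {s : E | ∃ z g : ℕ → E, Tendsto z atTop (𝓝 x) ∧
    (∀ n, HasGradientAt f (g n) (z n)) ∧ Tendsto g atTop (𝓝 s)}

/-- The Fréchet subdifferential of a locally Lipschitz, directionally differentiable function: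
all `s` with `⟪s, v⟫ ≤ f'(x; v)` for every direction `v`. -/
def frechetSubdiff (f : E → ℝ) (x : E) : Set E :=
  {s : E | ∀ v : E, ∃ c : ℝ, HasDirDerivAt f x v c ∧ inner ℝ s v ≤ c}

/-- Clarke regularity at `x`. The notion presupposes that `f` is locally Lipschitz and
directionally differentiable; both are part of the definition. -/
structure ClarkeRegularAt [CompleteSpace E] (f : E → ℝ) (x : E) : Prop where
  locallyLipschitz : LocallyLipschitz f
  dirDifferentiable : DirDifferentiable f
  clarke_eq_frechet : clarkeSubdiff f x = frechetSubdiff f x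

end Subdifferentials

/-- The Euclidean space `(ℝ × ℝ ^ d) ^ H` of parameters `(u₁, w₁, …, u_H, w_H)`. -/
abbrev Params (H d : ℕ) : Type :=
  PiLp 2 (fun _ : Fin H => WithLp 2 (ℝ × EuclideanSpace ℝ (Fin d)))

/-- The output weight `u_k`. -/
def outWeight {H d : ℕ} (θ : Params H d) (k : Fin H) : ℝ := (θ k).fst

/-- The hidden weight vector `w_k`. -/
def hidWeight {H d : ℕ} (θ : Params H d) (k : Fin H) : EuclideanSpace ℝ (Fin d) := (θ k).snd

/-- The output `∑ k, u_k * max (⟪w_k, z⟫) 0` of the two-layer ReLU network on the input `z`. -/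
def network {H d : ℕ} (θ : Params H d) (z : EuclideanSpace ℝ (Fin d)) : ℝ :=
  ∑ k : Fin H, outWeight θ k * max (inner ℝ (hidWeight θ k) z) 0

section Data

variable {N d H : ℕ} (ℓ : ℝ × ℝ → ℝ) (x : Fin N → EuclideanSpace ℝ (Fin d)) (y : Fin N → ℝ)

/-- The empirical loss `L(θ) = ∑ i, ℓ (network θ x_i, y_i)`. -/
def empLoss (θ : Params H d) : ℝ :=
  ∑ i : Fin N, ℓ (network θ (x i), y i)

/-- `ρ_i`: the derivative of `t ↦ ℓ (t, y_i)` at the network output on `x_i`. -/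
def rho (θ : Params H d) (i : Fin N) : ℝ :=
  deriv (fun t : ℝ => ℓ (t, y i)) (network θ (x i))

/-- Indices `i` with `⟪w_k, x_i⟫ = 0` and `u_k * ρ_i ≥ 0`. -/
def idxPos (θ : Params H d) (k : Fin H) : Set (Fin N) :=
  {i | inner ℝ (hidWeight θ k) (x i) = 0 ∧ 0 ≤ outWeight θ k * rho ℓ x y θ i}

/-- Indices `i` with `⟪w_k, x_i⟫ = 0` and `u_k * ρ_i < 0`. -/
def idxNeg (θ : Params H d) (k : Fin H) : Set (Fin N) :=
  {i | inner ℝ (hidWeight θ k) (x i) = 0 ∧ outWeight θ k * rho ℓ x y θ i < 0}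

/-- The span qualification (SQ) at the point `θ`. -/
def SpanQualification (θ : Params H d) : Prop :=
  ∀ k : Fin H,
    Submodule.span ℝ (x '' idxPos ℓ x y θ k) ⊓ Submodule.span ℝ (x '' idxNeg ℓ x y θ k) = ⊥

/-- Data in general position: no `d` of the data points lie on one hyperplane through the origin
of `ℝ ^ d` (for `x = (x', 1)` with `x' ∈ ℝ ^ (d - 1)`: no `d` of the points `x'` lie on one affine
hyperplane). With fewer than `d` data points that condition is void; general position then means,
as usual, that the points are linearly independent (the `x'` affinely independent). -/
def InGeneralPosition : Prop :=
  (¬ ∃ w : EuclideanSpace ℝ (Fin d), w ≠ 0 ∧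
    ∃ J : Finset (Fin N), d ≤ J.card ∧ ∀ j ∈ J, inner ℝ w (x j) = 0) ∧
  (N < d → LinearIndependent ℝ x)

end Data

end ReLULoss

end

namespace ReLULoss

/-! Everything reduces to showing that `idxNeg` is empty for every node. The loss has an explicit
directional derivative `dirDeriv`, whose only nonlinear part is a sum of terms `u_k ρ_i max ⟪h_k,
x_i⟫ 0` over the ties `⟪w_k, x_i⟫ = 0`.

If no tie has a negative coefficient, `dirDeriv` is upper semicontinuous in the base point, so
limits of gradients are Fréchet subgradients. The opposite inclusion always holds: in a generic
direction `dirDeriv` is realized by one of finitely many limiting gradients, and a Fréchet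
subgradient outside their hull could be strictly separated from it by such a direction.

A Fréchet subgradient forces `f'(θ; v) + f'(θ; -v) ≥ 0`. For `v` moving only `w_k` by `h`, this sum
is `∑ u_k ρ_i |⟪h, x_i⟫|` over the ties. Under SQ, `h` can be chosen to kill the nonnegative terms
but not a given negative one, so negative ties cannot exist. For local minimizers the subgradient is
`0`, and general position gives SQ because tied data are linearly independent. -/

/-! ### Directional derivatives, separation and Lipschitz sums -/

theorem HasDirDerivAt.of_hasDerivWithinAt {E : Type*} [NormedAddCommGroup E]
    [InnerProductSpace ℝ E] {f : E → ℝ} {p v : E} {c : ℝ}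
    (h : HasDerivWithinAt (fun t : ℝ => f (p + t • v)) c (Set.Ioi 0) 0) :
    HasDirDerivAt f p v c := by
  rw [hasDerivWithinAt_iff_tendsto_slope' (by simp)] at h
  refine h.congr fun t => ?_
  simp [slope_def_field]

theorem hasDirDerivAt_of_hasGradientAt {E : Type*} [NormedAddCommGroup E]
    [InnerProductSpace ℝ E] [CompleteSpace E] {f : E → ℝ} {p g : E}
    (h : HasGradientAt f g p) (v : E) : HasDirDerivAt f p v (inner ℝ g v) := by
  apply HasDirDerivAt.of_hasDerivWithinAt
  have h1 := h.hasFDerivAt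
  have h2 : HasDerivAt (fun t : ℝ => p + t • v) v 0 := by
    simpa using ((hasDerivAt_id (0 : ℝ)).smul_const v).const_add p
  have h3 : HasFDerivAt f ((InnerProductSpace.toDual ℝ E) g) (p + (0 : ℝ) • v) := by simpa using h1
  simpa [Function.comp_def] using (h3.comp_hasDerivAt (0 : ℝ) h2).hasDerivWithinAt

theorem HasDirDerivAt.unique {E : Type*} [NormedAddCommGroup E]
    [InnerProductSpace ℝ E] {f : E → ℝ} {p v : E} {c c' : ℝ}
    (h : HasDirDerivAt f p v c) (h' : HasDirDerivAt f p v c') : c = c' :=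
  tendsto_nhds_unique h h'

theorem zero_mem_frechetSubdiff_of_isLocalMin {E : Type*} [NormedAddCommGroup E]
    [InnerProductSpace ℝ E] {f : E → ℝ} {p : E} (hf : DirDifferentiable f)
    (h : IsLocalMin f p) : (0 : E) ∈ frechetSubdiff f p := by
  intro v
  obtain ⟨c, hc⟩ := hf p v
  refine ⟨c, hc, ?_⟩
  rw [inner_zero_left]
  refine ge_of_tendsto hc ?_
  have h2 : Tendsto (fun t : ℝ => p + t • v) (𝓝[>] 0) (𝓝 p) := by
    have : Continuous fun t : ℝ => p + t • v := by fun_prop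
    simpa using (this.tendsto 0).mono_left nhdsWithin_le_nhds
  filter_upwards [h2.eventually h, self_mem_nhdsWithin] with t ht ht0
  exact div_nonneg (sub_nonneg.2 ht) (le_of_lt ht0)

theorem convex_frechetSubdiff {E : Type*} [NormedAddCommGroup E]
    [InnerProductSpace ℝ E] (f : E → ℝ) (p : E) : Convex ℝ (frechetSubdiff f p) := by
  intro s hs s' hs' a b ha hb hab v
  obtain ⟨c, hc, h⟩ := hs v
  obtain ⟨c', hc', h'⟩ := hs' v
  obtain rfl := hc.unique hc'
  refine ⟨c, hc, ?_⟩
  rw [inner_add_left, real_inner_smul_left, real_inner_smul_left]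
  calc a * inner ℝ s v + b * inner ℝ s' v ≤ a * c + b * c := by gcongr
    _ = c := by rw [← add_mul, hab, one_mul]

theorem dense_setOf_apply_ne_zero {E : Type*} [NormedAddCommGroup E] [NormedSpace ℝ E]
    {f : E →L[ℝ] ℝ} {p : E} (hp : f p ≠ 0) : Dense {v : E | f v ≠ 0} := by
  have hint : interior (f.toLinearMap.ker : Set E) = ∅ := by
    by_contra hn
    have htop := Submodule.eq_top_of_nonempty_interior' _ (Set.nonempty_iff_ne_empty.2 hn)
    have hm : p ∈ f.toLinearMap.ker := by rw [htop]; trivial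
    exact hp hm
  exact interior_eq_empty_iff_dense_compl.1 hint

/-- Hahn–Banach separates `s` from the compact hull; as `A` is finite, strict separation is an open
condition on the direction, which can therefore be moved into `D`. -/
theorem exists_mem_dense_forall_inner_lt {E : Type*} [NormedAddCommGroup E]
    [InnerProductSpace ℝ E] [CompleteSpace E] {A D : Set E} (hA : A.Finite) (hD : Dense D) {s : E}
    (hs : s ∉ convexHull ℝ A) : ∃ v ∈ D, ∀ a ∈ A, (inner ℝ a v : ℝ) < inner ℝ s v := by
  obtain ⟨f, u, hf, hu⟩ := geometric_hahn_banach_closed_point (convex_convexHull ℝ A)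
    (hA.isCompact_convexHull ℝ).isClosed hs
  obtain ⟨p, rfl⟩ := (InnerProductSpace.toDual ℝ E).surjective f
  have hopen : IsOpen {v : E | ∀ a ∈ A, (inner ℝ a v : ℝ) < inner ℝ s v} := by
    have : {v : E | ∀ a ∈ A, (inner ℝ a v : ℝ) < inner ℝ s v} =
        ⋂ a ∈ A, {v : E | (inner ℝ a v : ℝ) < inner ℝ s v} := by ext; simp
    rw [this]
    exact hA.isOpen_biInter fun a _ => isOpen_lt (by fun_prop) (by fun_prop)
  obtain ⟨v, hv, hvD⟩ := hD.inter_open_nonempty _ hopen ⟨p, fun a ha => by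
    have h1 := hf a (subset_convexHull ℝ A ha)
    rw [InnerProductSpace.toDual_apply_apply] at h1 hu
    rw [real_inner_comm, real_inner_comm p s]
    exact h1.trans hu⟩
  exact ⟨v, hvD, hv⟩

theorem locallyLipschitz_finset_sum {α ι : Type*} [PseudoEMetricSpace α] (s : Finset ι)
    {f : ι → α → ℝ} (hf : ∀ i ∈ s, LocallyLipschitz (f i)) :
    LocallyLipschitz fun a => ∑ i ∈ s, f i a := by
  classical
  induction s using Finset.induction_on with
  | empty => simpa using LocallyLipschitz.const (0 : ℝ)
  | insert i s hi ih =>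
    simp only [Finset.sum_insert hi]
    exact (hf i (by simp)).add (ih fun j hj => hf j (by simp [hj]))

/-! ### One-sided derivative of the ReLU along a line -/

/-- The right derivative at `t = 0` of `t ↦ max (a + t * b) 0`. -/
noncomputable def reluDir (a b : ℝ) : ℝ := if 0 < a then b else if a = 0 then max b 0 else 0

theorem reluDir_of_pos {a : ℝ} (h : 0 < a) (b : ℝ) : reluDir a b = b := if_pos h

theorem reluDir_of_neg {a : ℝ} (h : a < 0) (b : ℝ) : reluDir a b = 0 := by
  simp [reluDir, h.not_gt, h.ne]

theorem reluDir_zero (b : ℝ) : reluDir 0 b = max b 0 := by simp [reluDir]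

theorem reluDir_le_max (a b : ℝ) : reluDir a b ≤ max b 0 := by
  unfold reluDir; split_ifs <;> simp

theorem abs_reluDir_le (a b : ℝ) : |reluDir a b| ≤ |b| := by
  unfold reluDir; split_ifs
  · rfl
  · rcases le_total b 0 with h | h <;> simp [h]
  · simp

theorem hasDerivWithinAt_relu_line (a b : ℝ) :
    HasDerivWithinAt (fun t : ℝ => max (a + t * b) 0) (reluDir a b) (Set.Ioi 0) 0 := by
  have hline : HasDerivAt (fun t : ℝ => a + t * b) b 0 := by
    simpa using ((hasDerivAt_id (0 : ℝ)).mul_const b).const_add a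
  have hc : Tendsto (fun t : ℝ => a + t * b) (𝓝 0) (𝓝 a) := by
    simpa using hline.continuousAt.tendsto
  rcases lt_trichotomy a 0 with h | rfl | h
  · rw [reluDir_of_neg h]
    refine ((hasDerivAt_const (0 : ℝ) (0 : ℝ)).congr_of_eventuallyEq ?_).hasDerivWithinAt
    filter_upwards [hc.eventually (gt_mem_nhds h)] with t ht
    exact max_eq_right ht.le
  · rw [reluDir_zero]
    have h1 : HasDerivWithinAt (fun t : ℝ => t * max b 0) (max b 0) (Set.Ioi 0) 0 := by
      simpa using ((hasDerivAt_id (0 : ℝ)).mul_const (max b 0)).hasDerivWithinAt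
    refine h1.congr (fun t ht => ?_) (by simp)
    rw [mul_max_of_nonneg _ _ (le_of_lt ht)]; simp
  · rw [reluDir_of_pos h]
    refine (hline.congr_of_eventuallyEq ?_).hasDerivWithinAt
    filter_upwards [hc.eventually (lt_mem_nhds h)] with t ht
    exact max_eq_left ht.le

/-! ### Coordinates on the parameter space -/

section Params

variable {N d H : ℕ}

/-- The output weight of the `k`-th node as a continuous linear functional. -/
noncomputable def outCLM (k : Fin H) : Params H d →L[ℝ] ℝ :=
  (WithLp.fstL 2 ℝ ℝ (EuclideanSpace ℝ (Fin d))).comp (PiLp.proj 2 _ k)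

/-- The hidden weight of the `k`-th node as a continuous linear map. -/
noncomputable def hidCLM (k : Fin H) : Params H d →L[ℝ] EuclideanSpace ℝ (Fin d) :=
  (WithLp.sndL 2 ℝ ℝ (EuclideanSpace ℝ (Fin d))).comp (PiLp.proj 2 _ k)

@[simp] theorem outCLM_apply (k : Fin H) (θ : Params H d) : outCLM k θ = outWeight θ k := rfl

@[simp] theorem hidCLM_apply (k : Fin H) (θ : Params H d) : hidCLM k θ = hidWeight θ k := rfl

@[simp] theorem outWeight_add_smul (θ v : Params H d) (t : ℝ) (k : Fin H) :
    outWeight (θ + t • v) k = outWeight θ k + t * outWeight v k := rfl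

@[simp] theorem hidWeight_add_smul (θ v : Params H d) (t : ℝ) (k : Fin H) :
    hidWeight (θ + t • v) k = hidWeight θ k + t • hidWeight v k := rfl

theorem continuous_outWeight (k : Fin H) : Continuous fun θ : Params H d => outWeight θ k :=
  (outCLM k).continuous

theorem continuous_hidWeight (k : Fin H) : Continuous fun θ : Params H d => hidWeight θ k :=
  (hidCLM k).continuous

/-- The preactivation `⟪w_k, z⟫` as a continuous linear functional of the parameters. -/
noncomputable def preactCLM (k : Fin H) (z : EuclideanSpace ℝ (Fin d)) : Params H d →L[ℝ] ℝ :=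
  (innerSL ℝ z).comp (hidCLM k)

@[simp] theorem preactCLM_apply (k : Fin H) (z : EuclideanSpace ℝ (Fin d)) (θ : Params H d) :
    preactCLM k z θ = inner ℝ (hidWeight θ k) z := by
  simp [preactCLM, real_inner_comm]

theorem continuous_preact (k : Fin H) (z : EuclideanSpace ℝ (Fin d)) :
    Continuous fun θ : Params H d => inner ℝ (hidWeight θ k) z :=
  (continuous_hidWeight k).inner continuous_const

/-- The direction that changes only the hidden weight of the `k`-th node. -/
noncomputable def hidDir (k : Fin H) (h : EuclideanSpace ℝ (Fin d)) : Params H d :=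
  WithLp.toLp 2 (Pi.single k (WithLp.toLp 2 (0, h)))

theorem outWeight_hidDir (k j : Fin H) (h : EuclideanSpace ℝ (Fin d)) :
    outWeight (hidDir k h) j = 0 := by
  by_cases hj : j = k
  · subst hj; simp [outWeight, hidDir]
  · simp [outWeight, hidDir, hj]

theorem hidWeight_hidDir_self (k : Fin H) (h : EuclideanSpace ℝ (Fin d)) :
    hidWeight (hidDir k h) k = h := by
  simp [hidWeight, hidDir]

theorem hidWeight_hidDir_of_ne {k j : Fin H} (hj : j ≠ k) (h : EuclideanSpace ℝ (Fin d)) :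
    hidWeight (hidDir k h) j = 0 := by
  simp [hidWeight, hidDir, hj]

theorem hidDir_neg (k : Fin H) (h : EuclideanSpace ℝ (Fin d)) :
    hidDir k (-h) = -hidDir k h := by
  have : (WithLp.toLp 2 ((0 : ℝ), -h)) = -(WithLp.toLp 2 ((0 : ℝ), h)) := by
    rw [← WithLp.toLp_neg 2 ((0 : ℝ), h), Prod.neg_mk, neg_zero]
  rw [hidDir, hidDir, this, Pi.single_neg, WithLp.toLp_neg]

theorem continuous_network (z : EuclideanSpace ℝ (Fin d)) :
    Continuous fun θ : Params H d => network θ z :=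
  continuous_finsetSum _ fun k _ =>
    (continuous_outWeight k).mul ((continuous_preact k z).max continuous_const)

theorem locallyLipschitz_network (z : EuclideanSpace ℝ (Fin d)) :
    LocallyLipschitz fun θ : Params H d => network θ z := by
  refine locallyLipschitz_finset_sum _ fun k _ => ?_
  have hmul : LocallyLipschitz fun p : ℝ × ℝ => p.1 * p.2 :=
    (contDiff_fst.mul contDiff_snd : ContDiff ℝ 1 fun p : ℝ × ℝ => p.1 * p.2).locallyLipschitz
  have h1 : LocallyLipschitz fun θ : Params H d => outWeight θ k :=
    (outCLM k).lipschitz.locallyLipschitz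
  have h2 : LocallyLipschitz fun θ : Params H d => inner ℝ (hidWeight θ k) z := by
    simpa only [← preactCLM_apply] using (preactCLM k z).lipschitz.locallyLipschitz
  exact hmul.comp (h1.prodMk (h2.max_const 0))

/-! ### Directional derivative of the loss -/

variable {ℓ : ℝ × ℝ → ℝ} {x : Fin N → EuclideanSpace ℝ (Fin d)} {y : Fin N → ℝ}

theorem locallyLipschitz_empLoss (hℓ : ContDiff ℝ 1 ℓ) :
    LocallyLipschitz (empLoss (H := H) ℓ x y) :=
  locallyLipschitz_finset_sum _ fun i _ =>
    hℓ.locallyLipschitz.comp ((locallyLipschitz_network (x i)).prodMk (LocallyLipschitz.const (y i)))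

theorem hasDerivAt_slice (hℓ : ContDiff ℝ 1 ℓ) (b t : ℝ) :
    HasDerivAt (fun t : ℝ => ℓ (t, b)) (fderiv ℝ ℓ (t, b) (1, 0)) t :=
  ((hℓ.differentiable one_ne_zero (t, b)).hasFDerivAt).comp_hasDerivAt t
    ((hasDerivAt_id t).prodMk (hasDerivAt_const t b))

theorem hasDerivAt_rho (hℓ : ContDiff ℝ 1 ℓ) (θ : Params H d) (i : Fin N) :
    HasDerivAt (fun t : ℝ => ℓ (t, y i)) (rho ℓ x y θ i) (network θ (x i)) :=
  (hasDerivAt_slice hℓ _ _).differentiableAt.hasDerivAt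

theorem continuous_rho (hℓ : ContDiff ℝ 1 ℓ) (i : Fin N) :
    Continuous fun θ : Params H d => rho ℓ x y θ i := by
  have h : ∀ θ : Params H d,
      rho ℓ x y θ i = fderiv ℝ ℓ (network θ (x i), y i) (1, 0) := fun θ =>
    (hasDerivAt_slice hℓ _ _).deriv
  simp only [h]
  exact ((hℓ.continuous_fderiv one_ne_zero).comp
    ((continuous_network (x i)).prodMk continuous_const)).clm_apply continuous_const

variable (ℓ x y) in
/-- The directional derivative of the empirical loss at `θ` in the direction `v`. -/
noncomputable def dirDeriv (θ v : Params H d) : ℝ :=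
  ∑ i, rho ℓ x y θ i * ∑ k, (outWeight v k * max (inner ℝ (hidWeight θ k) (x i)) 0 +
    outWeight θ k * reluDir (inner ℝ (hidWeight θ k) (x i)) (inner ℝ (hidWeight v k) (x i)))

theorem hasDirDerivAt_empLoss (hℓ : ContDiff ℝ 1 ℓ) (θ v : Params H d) :
    HasDirDerivAt (empLoss ℓ x y) θ v (dirDeriv ℓ x y θ v) := by
  apply HasDirDerivAt.of_hasDerivWithinAt
  unfold empLoss dirDeriv
  refine HasDerivWithinAt.fun_sum fun i _ => ?_
  have hnet : HasDerivWithinAt (fun t : ℝ => network (θ + t • v) (x i))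
      (∑ k, (outWeight v k * max (inner ℝ (hidWeight θ k) (x i)) 0 +
        outWeight θ k * reluDir (inner ℝ (hidWeight θ k) (x i)) (inner ℝ (hidWeight v k) (x i))))
      (Set.Ioi 0) 0 := by
    unfold network
    refine HasDerivWithinAt.fun_sum fun k _ => ?_
    have h1 : HasDerivWithinAt (fun t : ℝ => outWeight θ k + t * outWeight v k)
        (outWeight v k) (Set.Ioi 0) 0 := by
      simpa using (((hasDerivAt_id (0 : ℝ)).mul_const (outWeight v k)).const_add
        (outWeight θ k)).hasDerivWithinAt
    have h2 := hasDerivWithinAt_relu_line (inner ℝ (hidWeight θ k) (x i))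
      (inner ℝ (hidWeight v k) (x i))
    simpa [inner_add_left, real_inner_smul_left] using h1.fun_mul h2
  have hρ := hasDerivAt_rho (x := x) (y := y) hℓ (θ + (0 : ℝ) • v) i
  simpa [Function.comp_def] using hρ.comp_hasDerivWithinAt (0 : ℝ) hnet

theorem dirDifferentiable_empLoss (hℓ : ContDiff ℝ 1 ℓ) :
    DirDifferentiable (empLoss (H := H) ℓ x y) :=
  fun θ v => ⟨_, hasDirDerivAt_empLoss hℓ θ v⟩

theorem mem_frechetSubdiff_empLoss (hℓ : ContDiff ℝ 1 ℓ) {θ s : Params H d} :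
    s ∈ frechetSubdiff (empLoss ℓ x y) θ ↔ ∀ v, inner ℝ s v ≤ dirDeriv ℓ x y θ v := by
  constructor
  · intro hs v
    obtain ⟨c, hc, h⟩ := hs v
    rwa [hc.unique (hasDirDerivAt_empLoss hℓ θ v)] at h
  · exact fun hs v => ⟨_, hasDirDerivAt_empLoss hℓ θ v, hs v⟩

/-! ### Activation patterns and limiting gradients -/

variable (ℓ x y) in
/-- The linear form that the derivative of the empirical loss takes on a region of parameters
where node `k` is active on the datum `x i` exactly if `σ k i` holds. -/
noncomputable def patternForm (θ : Params H d) (σ : Fin H → Fin N → Bool) : Params H d →L[ℝ] ℝ :=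
  ∑ i, rho ℓ x y θ i • ∑ k, (max (inner ℝ (hidWeight θ k) (x i)) 0 • outCLM k +
    (outWeight θ k * if σ k i then 1 else 0) • preactCLM k (x i))

theorem continuous_patternForm (hℓ : ContDiff ℝ 1 ℓ) (σ : Fin H → Fin N → Bool) :
    Continuous fun θ : Params H d => patternForm ℓ x y θ σ := by
  unfold patternForm
  refine continuous_finsetSum _ fun i _ => (continuous_rho hℓ i).smul ?_
  refine continuous_finsetSum _ fun k _ => .add ?_ ?_
  · exact ((continuous_preact k (x i)).max continuous_const).smul continuous_const
  · exact ((continuous_outWeight k).mul continuous_const).smul continuous_const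

variable (x) in
/-- The activation pattern at `θ + t • v` for small `t > 0`. -/
noncomputable def dirPattern (θ v : Params H d) (k : Fin H) (i : Fin N) : Bool :=
  decide (0 < (inner ℝ (hidWeight θ k) (x i) : ℝ) ∨
    (inner ℝ (hidWeight θ k) (x i) : ℝ) = 0 ∧ 0 < (inner ℝ (hidWeight v k) (x i) : ℝ))

theorem patternForm_dirPattern (θ v : Params H d) :
    patternForm ℓ x y θ (dirPattern x θ v) v = dirDeriv ℓ x y θ v := by
  simp only [patternForm, dirDeriv, sum_apply, smul_apply, add_apply,
    outCLM_apply, preactCLM_apply, smul_eq_mul]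
  refine Finset.sum_congr rfl fun i _ => ?_
  congr 1
  refine Finset.sum_congr rfl fun k _ => ?_
  rw [mul_comm (outWeight v k), mul_assoc]
  congr 2
  rcases lt_trichotomy (inner ℝ (hidWeight θ k) (x i) : ℝ) 0 with h | h | h
  · simp [reluDir_of_neg h, dirPattern, h.not_gt, h.ne]
  · rcases le_or_gt (inner ℝ (hidWeight v k) (x i) : ℝ) 0 with h' | h'
    · simp [h, reluDir_zero, dirPattern, h', h'.not_gt]
    · simp [h, reluDir_zero, dirPattern, h', h'.le]
  · simp [reluDir_of_pos h, dirPattern, h]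

/-- Without ties every activation is locally constant. The direction `0` in `dirPattern` is a dummy,
since there is no tie to break. -/
theorem hasFDerivAt_empLoss (hℓ : ContDiff ℝ 1 ℓ) {θ : Params H d}
    (hθ : ∀ k i, (inner ℝ (hidWeight θ k) (x i) : ℝ) ≠ 0) :
    HasFDerivAt (empLoss ℓ x y) (patternForm ℓ x y θ (dirPattern x θ 0)) θ := by
  unfold empLoss patternForm
  refine HasFDerivAt.fun_sum fun i _ => ?_
  refine HasDerivAt.comp_hasFDerivAt (f := fun θ : Params H d => network θ (x i)) θ
    (hasDerivAt_rho (x := x) (y := y) hℓ θ i) ?_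
  unfold network
  refine HasFDerivAt.fun_sum fun k _ => ?_
  have h1 : HasFDerivAt (fun θ : Params H d => outWeight θ k) (outCLM k) θ :=
    (outCLM k).hasFDerivAt
  have h2 : HasFDerivAt (fun θ : Params H d => (inner ℝ (hidWeight θ k) (x i) : ℝ))
      (preactCLM k (x i)) θ := by
    simpa only [← preactCLM_apply] using (preactCLM k (x i)).hasFDerivAt (x := θ)
  have h3 : HasFDerivAt (fun θ : Params H d => max (inner ℝ (hidWeight θ k) (x i) : ℝ) 0)
      ((if dirPattern x θ 0 k i then (1 : ℝ) else 0) • preactCLM k (x i)) θ := by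
    have hc := (continuous_preact k (x i)).continuousAt (x := θ)
    rcases lt_or_gt_of_ne (hθ k i) with h | h
    · have : dirPattern x θ 0 k i = false := by simp [dirPattern, h.not_gt, h.ne]
      rw [this]
      simp only [Bool.false_eq_true, if_false, zero_smul]
      refine (hasFDerivAt_const (0 : ℝ) θ).congr_of_eventuallyEq ?_
      filter_upwards [hc.eventually (gt_mem_nhds h)] with t ht
      exact max_eq_right ht.le
    · have : dirPattern x θ 0 k i = true := by simp [dirPattern, h]
      rw [this]
      simp only [if_true, one_smul]
      refine h2.congr_of_eventuallyEq ?_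
      filter_upwards [hc.eventually (lt_mem_nhds h)] with t ht
      exact max_eq_left ht.le
  have := h1.mul h3
  rwa [smul_smul, add_comm] at this

theorem eventually_dirPattern_eq (θ : Params H d) {v : Params H d}
    (hv : ∀ k i, (inner ℝ (hidWeight v k) (x i) : ℝ) ≠ 0) :
    ∀ᶠ t : ℝ in 𝓝[>] 0, (∀ k i, (inner ℝ (hidWeight (θ + t • v) k) (x i) : ℝ) ≠ 0) ∧
      dirPattern x (θ + t • v) 0 = dirPattern x θ v := by
  have key : ∀ k i, ∀ᶠ t : ℝ in 𝓝[>] 0, (inner ℝ (hidWeight (θ + t • v) k) (x i) : ℝ) ≠ 0 ∧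
      dirPattern x (θ + t • v) 0 k i = dirPattern x θ v k i := by
    intro k i
    have hc : Tendsto (fun t : ℝ => (inner ℝ (hidWeight (θ + t • v) k) (x i) : ℝ)) (𝓝[>] 0)
        (𝓝 (inner ℝ (hidWeight θ k) (x i))) := by
      have : Continuous fun t : ℝ => (inner ℝ (hidWeight (θ + t • v) k) (x i) : ℝ) :=
        (continuous_preact k (x i)).comp (by fun_prop)
      simpa using (this.tendsto 0).mono_left nhdsWithin_le_nhds
    rcases lt_trichotomy (inner ℝ (hidWeight θ k) (x i) : ℝ) 0 with h | h | h
    · filter_upwards [hc.eventually (gt_mem_nhds h)] with t ht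
      exact ⟨ht.ne, by
        rw [dirPattern, dirPattern, decide_eq_decide]; simp only [ht.not_gt, ht.ne, h.not_gt, h.ne,
          false_and, or_self]⟩
    · filter_upwards [self_mem_nhdsWithin] with t ht
      have ht : 0 < t := ht
      have e : (inner ℝ (hidWeight (θ + t • v) k) (x i) : ℝ) =
          t * inner ℝ (hidWeight v k) (x i) := by
        simp [inner_add_left, real_inner_smul_left, h]
      refine ⟨by rw [e]; exact mul_ne_zero ht.ne' (hv k i), ?_⟩
      simp only [dirPattern, e]
      simp [h, ht, ht.ne', hv k i]
    · filter_upwards [hc.eventually (lt_mem_nhds h)] with t ht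
      exact ⟨ht.ne', by
        rw [dirPattern, dirPattern, decide_eq_decide]; simp only [ht, h, true_or]⟩
  have := eventually_all.2 fun k => eventually_all.2 fun i => key k i
  filter_upwards [this] with t ht
  exact ⟨fun k i => (ht k i).1, funext fun k => funext fun i => (ht k i).2⟩

/-- Along `θ + t • v` with small `t > 0` there are no ties and the pattern is frozen, so the
gradients converge by continuity of `patternForm` in the base point. -/
theorem patternForm_mem_clarkeSubdiff (hℓ : ContDiff ℝ 1 ℓ) (θ : Params H d) {v : Params H d}
    (hv : ∀ k i, (inner ℝ (hidWeight v k) (x i) : ℝ) ≠ 0) :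
    (InnerProductSpace.toDual ℝ (Params H d)).symm (patternForm ℓ x y θ (dirPattern x θ v)) ∈
      clarkeSubdiff (empLoss ℓ x y) θ := by
  apply subset_convexHull
  obtain ⟨t, ht0, ht⟩ := exists_seq_forall_of_frequently
    (eventually_dirPattern_eq (x := x) θ hv).frequently
  have hz : Tendsto (fun n => θ + t n • v) atTop (𝓝 θ) := by
    have : Continuous fun t : ℝ => θ + t • v := by fun_prop
    simpa [Function.comp_def] using (this.tendsto 0).comp (ht0.mono_right nhdsWithin_le_nhds)
  refine ⟨fun n => θ + t n • v, fun n => (InnerProductSpace.toDual ℝ (Params H d)).symm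
    (patternForm ℓ x y (θ + t n • v) (dirPattern x θ v)), hz, fun n => ?_, ?_⟩
  · rw [hasGradientAt_iff_hasFDerivAt, LinearIsometryEquiv.apply_symm_apply, ← (ht n).2]
    exact hasFDerivAt_empLoss hℓ (ht n).1
  · exact (((InnerProductSpace.toDual ℝ (Params H d)).symm.continuous.comp
      (continuous_patternForm hℓ _)).tendsto θ).comp hz

theorem dense_generic_directions (hx : ∀ i, x i ≠ 0) :
    Dense {v : Params H d | ∀ k i, (inner ℝ (hidWeight v k) (x i) : ℝ) ≠ 0} := by
  have h : {v : Params H d | ∀ k i, (inner ℝ (hidWeight v k) (x i) : ℝ) ≠ 0} =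
      ⋂ p : Fin H × Fin N, {v : Params H d | (inner ℝ (hidWeight v p.1) (x p.2) : ℝ) ≠ 0} := by
    ext v; simp [Prod.forall]
  rw [h]
  refine dense_iInter_of_isOpen
    (fun p => isOpen_ne.preimage (continuous_preact p.1 (x p.2))) fun p => ?_
  have hp : preactCLM p.1 (x p.2) (hidDir p.1 (x p.2) : Params H d) ≠ 0 := by
    rw [preactCLM_apply, hidWeight_hidDir_self]
    exact inner_self_ne_zero.2 (hx p.2)
  simpa only [preactCLM_apply] using dense_setOf_apply_ne_zero hp

/-! ### The two inclusions between the subdifferentials -/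

theorem frechetSubdiff_subset_clarkeSubdiff (hℓ : ContDiff ℝ 1 ℓ) (hx : ∀ i, x i ≠ 0)
    (θ : Params H d) :
    frechetSubdiff (empLoss ℓ x y) θ ⊆ clarkeSubdiff (empLoss ℓ x y) θ := by
  intro s hs
  rw [mem_frechetSubdiff_empLoss hℓ] at hs
  set A : Set (Params H d) := (fun v => (InnerProductSpace.toDual ℝ (Params H d)).symm
    (patternForm ℓ x y θ (dirPattern x θ v))) ''
      {v | ∀ k i, (inner ℝ (hidWeight v k) (x i) : ℝ) ≠ 0} with hA
  -- There are only finitely many activation patterns.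
  have hfin : A.Finite := (Set.finite_range fun σ => (InnerProductSpace.toDual ℝ (Params H d)).symm
    (patternForm ℓ x y θ σ)).subset (by rintro _ ⟨v, -, rfl⟩; exact ⟨_, rfl⟩)
  have hsub : convexHull ℝ A ⊆ clarkeSubdiff (empLoss ℓ x y) θ := by
    refine convexHull_min ?_ (convex_convexHull ℝ _)
    rintro _ ⟨v, hv, rfl⟩
    exact patternForm_mem_clarkeSubdiff hℓ θ hv
  refine hsub ?_
  by_contra hsA
  obtain ⟨v, hgen, hv⟩ :=
    exists_mem_dense_forall_inner_lt hfin (dense_generic_directions (H := H) hx) hsA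
  have h1 := hv _ ⟨v, hgen, rfl⟩
  rw [InnerProductSpace.toDual_symm_apply, patternForm_dirPattern] at h1
  exact absurd (hs v) (not_le.2 h1)

/-- Upper semicontinuity of one term. At a tie, `max b 0` dominates every nearby value of `reluDir`,
and a nonnegative coefficient preserves this. -/
theorem tendsto_upper_bound_term {a : Params H d → ℝ} (ha : Continuous a) (θ : Params H d)
    (k : Fin H) (z h : EuclideanSpace ℝ (Fin d))
    (hpos : (inner ℝ (hidWeight θ k) z : ℝ) = 0 → 0 ≤ a θ) :
    ∃ B : Params H d → ℝ, Tendsto B (𝓝 θ)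
        (𝓝 (a θ * reluDir (inner ℝ (hidWeight θ k) z) (inner ℝ h z))) ∧
      ∀ᶠ θ' in 𝓝 θ, a θ' * reluDir (inner ℝ (hidWeight θ' k) z) (inner ℝ h z) ≤ B θ' := by
  have hc := (continuous_preact k z).continuousAt (x := θ)
  rcases lt_trichotomy (inner ℝ (hidWeight θ k) z : ℝ) 0 with h0 | h0 | h0
  · refine ⟨fun _ => 0, by simp [reluDir_of_neg h0], ?_⟩
    filter_upwards [hc.eventually (gt_mem_nhds h0)] with θ' hθ'
    simp [reluDir_of_neg hθ']
  -- The sign of `a` is known only at `θ` itself; the second summand absorbs its variation.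
  · refine ⟨fun θ' => a θ * max (inner ℝ h z) 0 + |a θ' - a θ| * |inner ℝ h z|, ?_,
      Eventually.of_forall fun θ' => ?_⟩
    · have : Continuous fun θ' => a θ * max (inner ℝ h z : ℝ) 0 + |a θ' - a θ| * |inner ℝ h z| := by
        fun_prop
      simpa [h0, reluDir_zero] using this.tendsto θ
    · set r := reluDir (inner ℝ (hidWeight θ' k) z) (inner ℝ h z)
      have h1 : a θ * r ≤ a θ * max (inner ℝ h z) 0 :=
        mul_le_mul_of_nonneg_left (reluDir_le_max _ _) (hpos h0)
      have h2 : (a θ' - a θ) * r ≤ |a θ' - a θ| * |inner ℝ h z| :=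
        (le_abs_self _).trans (by
          rw [abs_mul]; exact mul_le_mul_of_nonneg_left (abs_reluDir_le _ _) (abs_nonneg _))
      dsimp only
      linarith
  · refine ⟨fun θ' => a θ' * inner ℝ h z, ?_, ?_⟩
    · rw [reluDir_of_pos h0]
      exact (ha.tendsto θ).mul_const _
    · filter_upwards [hc.eventually (lt_mem_nhds h0)] with θ' hθ'
      rw [reluDir_of_pos hθ']

theorem exists_tendsto_dirDeriv_le (hℓ : ContDiff ℝ 1 ℓ) {θ : Params H d}
    (hneg : ∀ k, idxNeg ℓ x y θ k = ∅) (v : Params H d) :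
    ∃ B : Params H d → ℝ, Tendsto B (𝓝 θ) (𝓝 (dirDeriv ℓ x y θ v)) ∧
      ∀ᶠ θ' in 𝓝 θ, dirDeriv ℓ x y θ' v ≤ B θ' := by
  have key : ∀ i k, ∃ B : Params H d → ℝ, Tendsto B (𝓝 θ)
      (𝓝 (outWeight θ k * rho ℓ x y θ i *
        reluDir (inner ℝ (hidWeight θ k) (x i)) (inner ℝ (hidWeight v k) (x i)))) ∧
      ∀ᶠ θ' in 𝓝 θ, outWeight θ' k * rho ℓ x y θ' i *
        reluDir (inner ℝ (hidWeight θ' k) (x i)) (inner ℝ (hidWeight v k) (x i)) ≤ B θ' := by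
    intro i k
    refine tendsto_upper_bound_term (a := fun θ' => outWeight θ' k * rho ℓ x y θ' i)
      ((continuous_outWeight k).mul (continuous_rho hℓ i)) θ k (x i) (hidWeight v k) fun h0 => ?_
    by_contra hlt
    have : i ∈ idxNeg ℓ x y θ k := ⟨h0, not_le.1 hlt⟩
    simp [hneg k] at this
  choose B hB hle using key
  have hexp : ∀ θ' : Params H d, dirDeriv ℓ x y θ' v = ∑ i, ∑ k,
      (rho ℓ x y θ' i * (outWeight v k * max (inner ℝ (hidWeight θ' k) (x i)) 0) +
        outWeight θ' k * rho ℓ x y θ' i *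
        reluDir (inner ℝ (hidWeight θ' k) (x i)) (inner ℝ (hidWeight v k) (x i))) := by
    intro θ'
    refine Finset.sum_congr rfl fun i _ => ?_
    rw [Finset.mul_sum]
    exact Finset.sum_congr rfl fun k _ => by ring
  refine ⟨fun θ' => ∑ i, ∑ k,
    (rho ℓ x y θ' i * (outWeight v k * max (inner ℝ (hidWeight θ' k) (x i)) 0) + B i k θ'), ?_, ?_⟩
  · rw [hexp]
    refine tendsto_finsetSum _ fun i _ => tendsto_finsetSum _ fun k _ => .add ?_ (hB i k)
    exact ((continuous_rho hℓ i).mul (continuous_const.mul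
      ((continuous_preact k (x i)).max continuous_const))).tendsto θ
  · filter_upwards [eventually_all.2 fun i => eventually_all.2 fun k => hle i k] with θ' h
    rw [hexp]
    exact Finset.sum_le_sum fun i _ => Finset.sum_le_sum fun k _ => by gcongr; exact h i k

theorem clarkeSubdiff_subset_frechetSubdiff (hℓ : ContDiff ℝ 1 ℓ) {θ : Params H d}
    (hneg : ∀ k, idxNeg ℓ x y θ k = ∅) :
    clarkeSubdiff (empLoss ℓ x y) θ ⊆ frechetSubdiff (empLoss ℓ x y) θ := by
  refine convexHull_min ?_ (convex_frechetSubdiff _ _)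
  rintro s ⟨z, g, hz, hg, hs⟩
  rw [mem_frechetSubdiff_empLoss hℓ]
  intro v
  obtain ⟨B, hB, hle⟩ := exists_tendsto_dirDeriv_le hℓ hneg v
  -- At the differentiability points `z n`, pairing the gradient with `v` gives `dirDeriv`, which
  -- `B` bounds.
  refine le_of_tendsto_of_tendsto (hs.inner tendsto_const_nhds) (hB.comp hz) ?_
  filter_upwards [hz.eventually hle] with n hn
  rwa [← (hasDirDerivAt_of_hasGradientAt (hg n) v).unique (hasDirDerivAt_empLoss hℓ _ v)] at hn

theorem clarkeRegularAt_of_idxNeg_eq_empty (hℓ : ContDiff ℝ 1 ℓ) (hx : ∀ i, x i ≠ 0)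
    {θ : Params H d} (hneg : ∀ k, idxNeg ℓ x y θ k = ∅) :
    ClarkeRegularAt (empLoss ℓ x y) θ :=
  ⟨locallyLipschitz_empLoss hℓ, dirDifferentiable_empLoss hℓ,
    (clarkeSubdiff_subset_frechetSubdiff hℓ hneg).antisymm
      (frechetSubdiff_subset_clarkeSubdiff hℓ hx θ)⟩

/-! ### Excluding negative ties under SQ -/

/-- Active data contribute linearly and cancel; ties contribute through `max b 0 + max (-b) 0 =
|b|`. -/
theorem dirDeriv_hidDir_add_neg (θ : Params H d) (k : Fin H) (h : EuclideanSpace ℝ (Fin d)) :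
    dirDeriv ℓ x y θ (hidDir k h) + dirDeriv ℓ x y θ (hidDir k (-h)) =
      ∑ i, if (inner ℝ (hidWeight θ k) (x i) : ℝ) = 0
        then outWeight θ k * rho ℓ x y θ i * |inner ℝ h (x i)| else 0 := by
  have hred : ∀ h, dirDeriv ℓ x y θ (hidDir k h) = ∑ i, rho ℓ x y θ i *
      (outWeight θ k * reluDir (inner ℝ (hidWeight θ k) (x i)) (inner ℝ h (x i))) := by
    intro h
    refine Finset.sum_congr rfl fun i _ => ?_
    congr 1
    rw [Finset.sum_eq_single k]
    · simp [outWeight_hidDir, hidWeight_hidDir_self]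
    · intro j _ hj
      simp [outWeight_hidDir, hidWeight_hidDir_of_ne hj, reluDir]
    · simp
  rw [hred, hred, ← Finset.sum_add_distrib]
  refine Finset.sum_congr rfl fun i _ => ?_
  rw [inner_neg_left]
  rcases lt_trichotomy (inner ℝ (hidWeight θ k) (x i) : ℝ) 0 with h0 | h0 | h0
  · simp [reluDir_of_neg h0, h0.ne]
  · rw [h0, reluDir_zero, reluDir_zero, if_pos rfl]
    rcases le_total (inner ℝ h (x i) : ℝ) 0 with hb | hb
    · rw [max_eq_right hb, max_eq_left (by linarith), abs_of_nonpos hb]; ring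
    · rw [max_eq_left hb, max_eq_right (by linarith), abs_of_nonneg hb]; ring
  · simp only [reluDir_of_pos h0, if_neg h0.ne']; ring

theorem idxNeg_eq_empty_of_spanQualification (hℓ : ContDiff ℝ 1 ℓ) (hx : ∀ i, x i ≠ 0)
    {θ : Params H d} (hSQ : SpanQualification ℓ x y θ)
    (hF : (frechetSubdiff (empLoss ℓ x y) θ).Nonempty) (k : Fin H) :
    idxNeg ℓ x y θ k = ∅ := by
  by_contra hne
  obtain ⟨j, hj⟩ := Set.nonempty_iff_ne_empty.2 hne
  obtain ⟨s, hs⟩ := hF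
  rw [mem_frechetSubdiff_empLoss hℓ] at hs
  set V := Submodule.span ℝ (x '' idxPos ℓ x y θ k)
  have hjV : x j ∉ V := fun hmem => hx j <| by
    have : x j ∈ V ⊓ Submodule.span ℝ (x '' idxNeg ℓ x y θ k) :=
      ⟨hmem, Submodule.subset_span ⟨j, hj, rfl⟩⟩
    rwa [hSQ k, Submodule.mem_bot] at this
  -- `x j ∉ V = Vᗮᗮ`, so some `h ∈ Vᗮ` detects `x j`.
  obtain ⟨h, hh, hhj⟩ : ∃ h ∈ Vᗮ, (inner ℝ h (x j) : ℝ) ≠ 0 := by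
    by_contra! hcon
    apply hjV
    rw [← Submodule.orthogonal_orthogonal V]
    exact hcon
  have h1 : (0 : ℝ) ≤ dirDeriv ℓ x y θ (hidDir k h) + dirDeriv ℓ x y θ (hidDir k (-h)) := by
    have := add_le_add (hs (hidDir k h)) (hs (hidDir k (-h)))
    rwa [hidDir_neg, inner_neg_right, add_neg_cancel, ← hidDir_neg] at this
  rw [dirDeriv_hidDir_add_neg] at h1
  refine absurd h1 (not_le.2 (Finset.sum_neg' (fun i _ => ?_) ⟨j, Finset.mem_univ j, ?_⟩))
  · split_ifs with h0
    · rcases le_or_gt 0 (outWeight θ k * rho ℓ x y θ i) with hp | hn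
      · have : (inner ℝ h (x i) : ℝ) = 0 := by
          rw [real_inner_comm]
          exact hh (x i) (Submodule.subset_span ⟨i, ⟨h0, hp⟩, rfl⟩)
        simp [this]
      · exact mul_nonpos_of_nonpos_of_nonneg hn.le (abs_nonneg _)
    · rfl
  · rw [if_pos hj.1]
    exact mul_neg_of_neg_of_pos hj.2 (abs_pos.2 hhj)

/-! ### General position implies SQ -/

/-- If `d ≤ N`, enlarge `J` to exactly `d` points: no nonzero vector is orthogonal to all of them,
so they span and form a basis. -/
theorem InGeneralPosition.linearIndepOn (hgp : InGeneralPosition x) {J : Finset (Fin N)}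
    (hJ : J.card ≤ d) : LinearIndepOn ℝ x (J : Set (Fin N)) := by
  rcases lt_or_ge N d with hN | hN
  · exact (hgp.2 hN).comp _ Subtype.val_injective
  · obtain ⟨K, hJK, -, hK⟩ := Finset.exists_subsuperset_card_eq (Finset.subset_univ J) hJ
      (by simpa using hN)
    refine LinearIndepOn.mono (s := (K : Set (Fin N))) ?_ (by exact_mod_cast hJK)
    refine linearIndependent_of_top_le_span_of_card_eq_finrank ?_ (by simp [hK])
    rw [top_le_iff, ← Submodule.orthogonal_eq_bot_iff, Submodule.eq_bot_iff]
    intro w hw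
    by_contra hw0
    refine hgp.1 ⟨w, hw0, K, hK.ge, fun j hj => ?_⟩
    rw [real_inner_comm]
    exact hw (x j) (Submodule.subset_span ⟨⟨j, hj⟩, rfl⟩)

theorem InGeneralPosition.spanQualification (hgp : InGeneralPosition x) {θ : Params H d}
    (hθ : ∀ k, hidWeight θ k = 0 → outWeight θ k = 0 ∨ N ≤ d) :
    SpanQualification ℓ x y θ := by
  classical
  intro k
  by_cases hu : outWeight θ k = 0
  · have : idxNeg ℓ x y θ k = ∅ := by simp [idxNeg, hu]
    simp [this]
  set J : Finset (Fin N) := {i | (inner ℝ (hidWeight θ k) (x i) : ℝ) = 0} with hJdef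
  -- A nonzero `w_k` is normal to a hyperplane containing all tied data; if `w_k = 0` everything is
  -- tied and `N ≤ d` is needed.
  have hJ : J.card ≤ d := by
    by_cases hw : hidWeight θ k = 0
    · have hN : N ≤ d := (hθ k hw).resolve_left hu
      exact (Finset.card_le_univ J).trans (by simpa using hN)
    · by_contra hlt
      exact hgp.1 ⟨_, hw, J, (not_le.1 hlt).le, fun j hj => by simpa [hJdef] using hj⟩
  have hli := hgp.linearIndepOn hJ
  have hsplit : ∀ S ⊆ (J : Set (Fin N)),
      x '' S = (fun j : (J : Set (Fin N)) => x j) '' (Subtype.val ⁻¹' S) := by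
    intro S hS
    ext z
    constructor
    · rintro ⟨i, hi, rfl⟩
      exact ⟨⟨i, hS hi⟩, hi, rfl⟩
    · rintro ⟨i, hi, rfl⟩
      exact ⟨i, hi, rfl⟩
  rw [hsplit (idxPos ℓ x y θ k) (fun i hi => by simpa [hJdef] using hi.1),
    hsplit (idxNeg ℓ x y θ k) (fun i hi => by simpa [hJdef] using hi.1)]
  -- Disjoint subfamilies of an independent family have disjoint spans.
  refine (LinearIndependent.disjoint_span_image hli ?_).eq_bot
  rw [Set.disjoint_left]
  exact fun i hp hn => not_lt.2 hp.2 hn.2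

end Params

end ReLULoss

theorem corollary3 {N d H : ℕ} (ℓ : ℝ × ℝ → ℝ)
    (hℓ : ContDiff ℝ 1 ℓ) (hℓ' : LocallyLipschitz (fderiv ℝ ℓ))
    (x : Fin N → EuclideanSpace ℝ (Fin d)) (y : Fin N → ℝ) (hx : ∀ i, x i ≠ 0) :
    (∀ θ : ReLULoss.Params H d,
      ReLULoss.SpanQualification ℓ x y θ →
      (ReLULoss.frechetSubdiff (ReLULoss.empLoss ℓ x y) θ).Nonempty →
      ReLULoss.ClarkeRegularAt (ReLULoss.empLoss ℓ x y) θ) ∧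
    (ReLULoss.InGeneralPosition x →
      ∀ θ : ReLULoss.Params H d,
      (∀ k, ReLULoss.hidWeight θ k = 0 → ReLULoss.outWeight θ k = 0 ∨ N ≤ d) →
      IsLocalMin (ReLULoss.empLoss ℓ x y) θ →
      ReLULoss.ClarkeRegularAt (ReLULoss.empLoss ℓ x y) θ) := by
  have key : ∀ θ : ReLULoss.Params H d, ReLULoss.SpanQualification ℓ x y θ →
      (ReLULoss.frechetSubdiff (ReLULoss.empLoss ℓ x y) θ).Nonempty →
      ReLULoss.ClarkeRegularAt (ReLULoss.empLoss ℓ x y) θ := fun θ hSQ hF =>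
    ReLULoss.clarkeRegularAt_of_idxNeg_eq_empty hℓ hx
      (ReLULoss.idxNeg_eq_empty_of_spanQualification hℓ hx hSQ hF)
  exact ⟨key, fun hgp θ hθ hmin => key θ (hgp.spanQualification hθ)
    ⟨0, ReLULoss.zero_mem_frechetSubdiff_of_isLocalMin
      (ReLULoss.dirDifferentiable_empLoss hℓ) hmin⟩⟩
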